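/- For $k\ge 1$ let $r_k(t)=\operatorname{sign}(\sin(2^k\pi t))$ be the Rademacher functions on $[0,1]$. Let $Y\neq\{0\}$ be a (real) Banach space of cotype $2$, i.e. for some $s>0$ there is a constant $C>0$ such that $$\Big(\sum_{k=1}^n\|y_k\|^2\Big)^{1/2}\le C\Big(\int_{[0,1]}\Big\|\sum_{k=1}^n r_k(t)y_k\Big\|^s\,dt\Big)^{1/s}$$ for every $n$ and all $y_1,\dots,y_n\in Y$. Let $m\ge 1$ be an integer and let $p>0$. Then there is a constant $c_{m,p}>0$ (depending only on $m$, $p$ and $Y$) such that for every $0<r\le 2$, every integer $n\ge 1$ and every array $(y_{i_1\dots i_m})_{i_1,\dots,i_m=1}^n$ in $Y$, $$\Big(\sum_{i_1,\dots,i_m=1}^n\|y_{i_1\dots i_m}\|^r\Big)^{1/r}\le c_{m,p}\,n^{m\left(\frac1r-\frac12\right)}\Big(\int_{[0,1]^m}\Big\|\sum_{i_1,\dots,i_m=1}^n r_{i_1}(t_1)\cdots r_{i_m}(t_m)\,y_{i_1\dots i_m}\Big\|^p\,dt_1\cdots dt_m\Big)^{1/p}.$$ Moreover the exponent $m\left(\frac1r-\frac12\right)$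 is optimal: for every $0<r\le2$, if $t\in\mathbb R$ and $c>0$ are such that $$\Big(\sum_{i_1,\dots,i_m=1}^n\|y_{i_1\dots i_m}\|^r\Big)^{1/r}\le c\,n^{t}\Big(\int_{[0,1]^m}\Big\|\sum_{i_1,\dots,i_m=1}^n r_{i_1}(t_1)\cdots r_{i_m}(t_m)\,y_{i_1\dots i_m}\Big\|^p\,dt_1\cdots dt_m\Big)^{1/p}$$ for all $n\ge1$ and all arrays in $Y$, then $t\ge m\left(\frac1r-\frac12\right)$. -/

import Mathlib

noncomputable section

/-- The Rademacher functions `r_k(t) = sign (sin (2 ^ k π t))`, used for `k ≥ 1`. -/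
def rademacher (k : ℕ) (t : ℝ) : ℝ :=
  Real.sign (Real.sin (2 ^ k * Real.pi * t))

/-- Cotype `q`, with the Rademacher averages taken in `L_s([0,1])`: for some `C > 0`,
`(∑ ‖y_k‖ ^ q) ^ (1/q) ≤ C (∫_{[0,1]} ‖∑ r_k(t) y_k‖ ^ s dt) ^ (1/s)` for all finite families
`y_1, …, y_n` in `Y`. The index `k : Fin n` stands for `k + 1` in `{1, …, n}`. -/
def HasCotype (Y : Type*) [NormedAddCommGroup Y] [NormedSpace ℝ Y] (q s : ℝ) : Prop :=
  ∃ C : ℝ, 0 < C ∧ ∀ (n : ℕ) (y : Fin n → Y),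
    (∑ k, ‖y k‖ ^ q) ^ (1 / q) ≤
      C * (∫ t in Set.Icc (0 : ℝ) 1, ‖∑ k : Fin n, rademacher ((k : ℕ) + 1) t • y k‖ ^ s) ^ (1 / s)

/-- The `L_p([0,1]^m)` (quasi-)norm of the Rademacher chaos
`∑ r_{i_1}(t_1) ⋯ r_{i_m}(t_m) y_{i_1 … i_m}` of an array `y`.
The index `i j : Fin n` stands for `i j + 1` in `{1, …, n}`. -/
def chaosNorm {Y : Type*} [NormedAddCommGroup Y] [NormedSpace ℝ Y] {m n : ℕ} (p : ℝ)
    (y : (Fin m → Fin n) → Y) : ℝ :=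
  (∫ t in Set.Icc (0 : Fin m → ℝ) 1,
    ‖∑ i, (∏ j, rademacher ((i j : ℕ) + 1) (t j)) • y i‖ ^ p) ^ (1 / p)

end

/-! The Rademacher functions are almost everywhere signs of binary digits, so `chaosNorm` is an
`L_p` norm of a decoupled chaos on a discrete cube with uniform measure. There everything reduces to
`p = 2`: a vector-valued Kahane–Khinchine inequality makes all `L_p` norms of chaoses of order `m`
equivalent, uniformly in `n`. It comes from hypercontractivity: the chaos is an eigenvector of the
noise operator with eigenvalue `2^(-m)`, and positivity of the operator transfers the scalar `(2,
4)` bound to norms.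

In `L_2` cotype 2 is iterated one variable at a time (`sum_norm_sq_le_boolChaos`), which gives `r =
2`; Hölder on the `n^m` indices gives `r < 2`. For optimality, a constant array `v ≠ 0` has left
side `n^(m/r) ‖v‖` and `L_2` norm `n^(m/2) ‖v‖`; only the bound of `L_p` by `L_2` is needed there.
-/

/-! ### Hypercontractive kernels and tensorization -/

/-- The `(2, 4)`-hypercontractive inequality for the averaging operator with kernel `κ`
on a finite set with its uniform probability measure. -/
def HypercontractiveKernel {X : Type*} [Fintype X] (κ : X → X → ℝ) : Prop :=
  ∀ g : X → ℝ, (Fintype.card X : ℝ) * ∑ x, (∑ y, κ x y * g y) ^ 4 ≤ (∑ x, g x ^ 2) ^ 2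

/-- Apply `θ` in the second variable, then `κ` in the first with the second frozen. The resulting
square of `∑ y, F y w ^ 2` is expanded into pairs `(y, y')`; Cauchy–Schwarz in `w` reduces each pair
to the fourth-moment bounds for `θ`. -/
theorem HypercontractiveKernel.prod {X Z : Type*} [Fintype X] [Fintype Z] {κ : X → X → ℝ}
    {θ : Z → Z → ℝ} (hκ : HypercontractiveKernel κ) (hθ : HypercontractiveKernel θ) :
    HypercontractiveKernel (fun a b : X × Z => κ a.1 b.1 * θ a.2 b.2) := by
  intro g
  set F : X → Z → ℝ := fun y w => ∑ z, θ w z * g (y, z) with hF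
  set A : X → ℝ := fun y => ∑ z, g (y, z) ^ 2 with hA
  have hA0 : ∀ y, 0 ≤ A y := fun y => Finset.sum_nonneg fun _ _ => sq_nonneg _
  have hcZ : (0 : ℝ) ≤ Fintype.card Z := Nat.cast_nonneg _
  have hT : ∀ a : X × Z, ∑ b : X × Z, κ a.1 b.1 * θ a.2 b.2 * g b = ∑ y, κ a.1 y * F y a.2 := by
    intro a
    rw [Fintype.sum_prod_type]
    refine Finset.sum_congr rfl fun y _ => ?_
    rw [hF, Finset.mul_sum]
    exact Finset.sum_congr rfl fun z _ => by ring
  have hFF : ∀ y y', (Fintype.card Z : ℝ) * ∑ w, F y w ^ 2 * F y' w ^ 2 ≤ A y * A y' := by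
    intro y y'
    refine abs_le_of_sq_le_sq' ?_ (mul_nonneg (hA0 y) (hA0 y')) |>.2
    have h1 := hθ fun z => g (y, z)
    have h2 := hθ fun z => g (y', z)
    have h3 := Finset.sum_mul_sq_le_sq_mul_sq Finset.univ (fun w => F y w ^ 2) (fun w => F y' w ^ 2)
    have h4 : ∀ x, ∑ w, (F x w ^ 2) ^ 2 = ∑ w, F x w ^ 4 := fun x =>
      Finset.sum_congr rfl fun w _ => by ring
    rw [h4, h4] at h3
    calc ((Fintype.card Z : ℝ) * ∑ w, F y w ^ 2 * F y' w ^ 2) ^ 2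
        ≤ (Fintype.card Z : ℝ) ^ 2 * ((∑ w, F y w ^ 4) * ∑ w, F y' w ^ 4) := by
          rw [mul_pow]; gcongr
      _ = ((Fintype.card Z : ℝ) * ∑ w, F y w ^ 4) * ((Fintype.card Z : ℝ) * ∑ w, F y' w ^ 4) := by
          ring
      _ ≤ A y ^ 2 * A y' ^ 2 := mul_le_mul h1 h2
          (mul_nonneg hcZ (Finset.sum_nonneg fun _ _ => by positivity)) (sq_nonneg _)
      _ = (A y * A y') ^ 2 := by ring
  have hsum : ∑ w, (∑ y, F y w ^ 2) ^ 2 = ∑ y, ∑ y', ∑ w, F y w ^ 2 * F y' w ^ 2 := by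
    simp_rw [sq (∑ y, F y _ ^ 2), Finset.sum_mul_sum]
    rw [Finset.sum_comm]
    exact Finset.sum_congr rfl fun y _ => Finset.sum_comm
  calc (Fintype.card (X × Z) : ℝ) * ∑ a : X × Z, (∑ b : X × Z, κ a.1 b.1 * θ a.2 b.2 * g b) ^ 4
      = (Fintype.card Z : ℝ) * ∑ w, (Fintype.card X : ℝ) * ∑ x, (∑ y, κ x y * F y w) ^ 4 := by
        simp_rw [hT]
        rw [Fintype.sum_prod_type, Finset.sum_comm, Fintype.card_prod, Finset.mul_sum,
          Finset.mul_sum]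
        push_cast
        exact Finset.sum_congr rfl fun w _ => by ring
    _ ≤ (Fintype.card Z : ℝ) * ∑ w, (∑ y, F y w ^ 2) ^ 2 := by
        gcongr with w
        exact hκ fun y => F y w
    _ = ∑ y, ∑ y', (Fintype.card Z : ℝ) * ∑ w, F y w ^ 2 * F y' w ^ 2 := by
        rw [hsum, Finset.mul_sum]
        simp_rw [Finset.mul_sum]
    _ ≤ ∑ y, ∑ y', A y * A y' := Finset.sum_le_sum fun y _ => Finset.sum_le_sum fun y' _ => hFF y y'
    _ = (∑ a : X × Z, g a ^ 2) ^ 2 := by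
        rw [Fintype.sum_prod_type, sq, Finset.sum_mul_sum]

theorem HypercontractiveKernel.pi {X : Type*} [Fintype X] {κ : X → X → ℝ}
    (hκ : HypercontractiveKernel κ) (d : ℕ) :
    HypercontractiveKernel (fun a b : Fin d → X => ∏ j, κ (a j) (b j)) := by
  induction d with
  | zero => intro g; simp [← pow_mul]
  | succ d ih =>
    intro g
    have h := hκ.prod ih fun a => g (Fin.consEquiv (fun _ => X) a)
    rw [← Equiv.sum_comp (Fin.consEquiv fun _ : Fin (d + 1) => X),
      ← Equiv.sum_comp (Fin.consEquiv fun _ : Fin (d + 1) => X),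
      ← Fintype.card_congr (Fin.consEquiv fun _ : Fin (d + 1) => X)]
    convert h using 5 with a
    rw [← Equiv.sum_comp (Fin.consEquiv fun _ : Fin (d + 1) => X)]
    refine Finset.sum_congr rfl fun b _ => ?_
    simp [Fin.consEquiv, Fin.prod_univ_succ]

/-! ### The noise operator on the cube -/

/-- The sign `±1` encoded by a boolean. -/
noncomputable def boolSign (b : Bool) : ℝ := if b then 1 else -1

@[simp] theorem boolSign_true : boolSign true = 1 := rfl

@[simp] theorem boolSign_false : boolSign false = -1 := rfl

/-- The kernel on `{-1, 1}` of the noise operator with parameter `1 / 2`. -/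
noncomputable def noiseKernel (a b : Bool) : ℝ := (1 + boolSign a * boolSign b / 2) / 2

theorem noiseKernel_nonneg (a b : Bool) : 0 ≤ noiseKernel a b := by
  cases a <;> cases b <;> norm_num [noiseKernel]

theorem sum_noiseKernel (a : Bool) : ∑ b, noiseKernel a b = 1 := by
  cases a <;> norm_num [noiseKernel]

theorem sum_noiseKernel_mul_boolSign (a : Bool) :
    ∑ b, noiseKernel a b * boolSign b = boolSign a / 2 := by
  cases a <;> norm_num [noiseKernel]

theorem hypercontractiveKernel_noiseKernel : HypercontractiveKernel noiseKernel := by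
  intro g
  simp only [Fintype.card_bool, Fintype.sum_bool, noiseKernel, boolSign_true, boolSign_false]
  generalize g true = a
  generalize g false = b
  norm_num
  -- With `u = (a + b) / 2` and `v = (a - b) / 2` the claim is `u^4 + (3/2) u^2 v^2 + v^4/16 ≤ (u^2
  -- + v^2)^2`; the gap is a positive combination of `u^2 v^2` and `v^4`.
  have h1 := sq_nonneg (a ^ 2 - b ^ 2)
  have h2 := mul_nonneg (sq_nonneg (a - b)) (sq_nonneg (a + b))
  have h3 := mul_nonneg (sq_nonneg (a - b)) (sq_nonneg (a - b))
  nlinarith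

/-- The kernel of the noise operator on `{-1, 1}^(m × n)`. -/
noncomputable def cubeKernel {m n : ℕ} (a b : Fin m → Fin n → Bool) : ℝ :=
  ∏ j, ∏ k, noiseKernel (a j k) (b j k)

theorem hypercontractiveKernel_cubeKernel (m n : ℕ) :
    HypercontractiveKernel (cubeKernel (m := m) (n := n)) :=
  (hypercontractiveKernel_noiseKernel.pi n).pi m

theorem cubeKernel_nonneg {m n : ℕ} (a b : Fin m → Fin n → Bool) : 0 ≤ cubeKernel a b :=
  Finset.prod_nonneg fun _ _ => Finset.prod_nonneg fun _ _ => noiseKernel_nonneg _ _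

theorem sum_pi_prod {ι X : Type*} [Fintype ι] [DecidableEq ι] [Fintype X] (F : ι → X → ℝ) :
    ∑ b : ι → X, ∏ j, F j (b j) = ∏ j, ∑ x, F j x := by
  rw [Finset.prod_univ_sum, Fintype.piFinset_univ]

theorem sum_cubeKernel {m n : ℕ} (a : Fin m → Fin n → Bool) : ∑ b, cubeKernel a b = 1 := by
  unfold cubeKernel
  rw [sum_pi_prod fun j (x : Fin n → Bool) => ∏ k, noiseKernel (a j k) (x k)]
  refine Finset.prod_eq_one fun j _ => ?_
  rw [sum_pi_prod fun k x => noiseKernel (a j k) x]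
  exact Finset.prod_eq_one fun k _ => sum_noiseKernel _

/-- Each of the `m` blocks contributes exactly one sign, with eigenvalue `1 / 2`; every other
coordinate integrates to `1`. -/
theorem sum_cubeKernel_mul_prod_boolSign {m n : ℕ} (a : Fin m → Fin n → Bool)
    (i : Fin m → Fin n) :
    ∑ b, cubeKernel a b * ∏ j, boolSign (b j (i j)) =
      (1 / 2) ^ m * ∏ j, boolSign (a j (i j)) := by
  have h1 : ∀ (u : Fin n → Bool) (k₀ : Fin n),
      ∑ v : Fin n → Bool, (∏ k, noiseKernel (u k) (v k)) * boolSign (v k₀)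
        = 1 / 2 * boolSign (u k₀) := by
    intro u k₀
    have : ∀ v : Fin n → Bool, (∏ k, noiseKernel (u k) (v k)) * boolSign (v k₀) =
        ∏ k, noiseKernel (u k) (v k) * if k = k₀ then boolSign (v k) else 1 := by
      intro v
      rw [Finset.prod_mul_distrib, Finset.prod_ite_eq' Finset.univ k₀]
      simp
    simp_rw [this]
    rw [sum_pi_prod fun k x => noiseKernel (u k) x * if k = k₀ then boolSign x else 1,
      Finset.prod_eq_single k₀]
    · simp only [if_true]
      rw [sum_noiseKernel_mul_boolSign]; ring
    · intro k _ hk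
      simp only [if_neg hk, mul_one]
      exact sum_noiseKernel _
    · simp
  unfold cubeKernel
  simp_rw [← Finset.prod_mul_distrib]
  rw [sum_pi_prod fun j (x : Fin n → Bool) => (∏ k, noiseKernel (a j k) (x k)) * boolSign (x (i j))]
  simp_rw [h1, Finset.prod_mul_distrib]
  simp

/-! ### Moments of vector-valued chaoses -/

section Chaos

variable {Y : Type*} [NormedAddCommGroup Y] [NormedSpace ℝ Y]

/-- The homogeneous decoupled chaos with coefficients `y` on the discrete cube. -/
noncomputable def boolChaos {m n : ℕ} (y : (Fin m → Fin n) → Y) (ω : Fin m → Fin n → Bool) : Y :=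
  ∑ i, (∏ j, boolSign (ω j (i j))) • y i

theorem sum_cubeKernel_smul_boolChaos {m n : ℕ} (y : (Fin m → Fin n) → Y)
    (a : Fin m → Fin n → Bool) :
    ∑ b, cubeKernel a b • boolChaos y b = ((1 / 2 : ℝ) ^ m) • boolChaos y a := by
  unfold boolChaos
  simp_rw [Finset.smul_sum, smul_smul]
  rw [Finset.sum_comm]
  refine Finset.sum_congr rfl fun i _ => ?_
  rw [← Finset.sum_smul, sum_cubeKernel_mul_prod_boolSign]

/-- Hypercontractivity is scalar, so it is applied to `‖boolChaos y ·‖ ^ N`. The eigenvector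
identity, the triangle inequality and Jensen for the probability weights `cubeKernel a` bound
`(2^(-m) ‖boolChaos y a‖) ^ N` pointwise by the image of that function. -/
theorem sum_norm_boolChaos_pow_le {m n : ℕ} (y : (Fin m → Fin n) → Y) (N : ℕ) :
    ((1 / 2 : ℝ) ^ m) ^ (4 * N) * ((Fintype.card (Fin m → Fin n → Bool) : ℝ) *
      ∑ ω, ‖boolChaos y ω‖ ^ (4 * N)) ≤ (∑ ω, ‖boolChaos y ω‖ ^ (2 * N)) ^ 2 := by
  have key : ∀ a, (((1 / 2 : ℝ) ^ m) * ‖boolChaos y a‖) ^ N ≤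
      ∑ b, cubeKernel a b * ‖boolChaos y b‖ ^ N := by
    intro a
    refine le_trans (pow_le_pow_left₀ (by positivity) ?_ N)
      (Real.pow_arith_mean_le_arith_mean_pow Finset.univ (cubeKernel a)
        (fun b => ‖boolChaos y b‖) (fun b _ => cubeKernel_nonneg a b) (sum_cubeKernel a)
        (fun b _ => norm_nonneg _) N)
    have h := norm_sum_le Finset.univ fun b => cubeKernel a b • boolChaos y b
    rw [sum_cubeKernel_smul_boolChaos, norm_smul] at h
    simp_rw [norm_smul, Real.norm_of_nonneg (cubeKernel_nonneg _ _)] at h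
    rwa [Real.norm_of_nonneg (by positivity)] at h
  have h := hypercontractiveKernel_cubeKernel m n fun b => ‖boolChaos y b‖ ^ N
  have e : ∀ b, (‖boolChaos y b‖ ^ N) ^ 2 = ‖boolChaos y b‖ ^ (2 * N) := fun b => by
    rw [← pow_mul, mul_comm]
  simp_rw [e] at h
  refine le_trans ?_ h
  rw [mul_left_comm, Finset.mul_sum]
  gcongr with a
  calc ((1 / 2 : ℝ) ^ m) ^ (4 * N) * ‖boolChaos y a‖ ^ (4 * N)
      = ((((1 / 2 : ℝ) ^ m) * ‖boolChaos y a‖) ^ N) ^ 4 := by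
        rw [← mul_pow, ← pow_mul, mul_comm 4 N]
    _ ≤ _ := by
        have := key a
        gcongr

end Chaos

/-! ### Norms on finite probability spaces -/

section AvgNorm

variable {Ω : Type*} [Fintype Ω]

/-- The `L_p` (quasi-)norm with respect to the uniform probability measure on a finite set. -/
noncomputable def avgNorm (p : ℝ) (g : Ω → ℝ) : ℝ :=
  ((∑ ω, g ω ^ p) / Fintype.card Ω) ^ (1 / p)

theorem avgNorm_nonneg {p : ℝ} {g : Ω → ℝ} (hg : ∀ ω, 0 ≤ g ω) : 0 ≤ avgNorm p g :=
  Real.rpow_nonneg (div_nonneg (Finset.sum_nonneg fun ω _ => Real.rpow_nonneg (hg ω) p)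
    (Nat.cast_nonneg _)) _

theorem avgNorm_rpow {p : ℝ} (hp : 0 < p) {g : Ω → ℝ} (hg : ∀ ω, 0 ≤ g ω) :
    avgNorm p g ^ p = (∑ ω, g ω ^ p) / Fintype.card Ω := by
  unfold avgNorm
  rw [← Real.rpow_mul (div_nonneg (Finset.sum_nonneg fun ω _ => Real.rpow_nonneg (hg ω) p)
    (Nat.cast_nonneg _)), one_div_mul_cancel hp.ne', Real.rpow_one]

theorem avgNorm_natCast_pow {k : ℕ} (hk : k ≠ 0) {g : Ω → ℝ} (hg : ∀ ω, 0 ≤ g ω) :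
    avgNorm k g ^ k = (∑ ω, g ω ^ k) / Fintype.card Ω := by
  have h := avgNorm_rpow (p := k) (by positivity) hg
  simpa only [Real.rpow_natCast] using h

theorem avgNorm_mono [Nonempty Ω] {p q : ℝ} (hp : 0 < p) (hpq : p ≤ q) {g : Ω → ℝ}
    (hg : ∀ ω, 0 ≤ g ω) : avgNorm p g ≤ avgNorm q g := by
  have hq : 0 < q := hp.trans_le hpq
  have hc : (Fintype.card Ω : ℝ) ≠ 0 := Nat.cast_ne_zero.2 Fintype.card_ne_zero
  have h := Real.arith_mean_le_rpow_mean Finset.univ (fun _ : Ω => (Fintype.card Ω : ℝ)⁻¹)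
    (fun ω => g ω ^ p) (fun _ _ => by positivity) (by simp [hc])
    (fun ω _ => Real.rpow_nonneg (hg ω) p) ((one_le_div hp).2 hpq)
  simp_rw [← Real.rpow_mul (hg _), mul_div_cancel₀ q hp.ne', ← Finset.mul_sum, inv_mul_eq_div] at h
  have h0 : 0 ≤ (∑ ω, g ω ^ p) / Fintype.card Ω :=
    div_nonneg (Finset.sum_nonneg fun ω _ => Real.rpow_nonneg (hg ω) p) (Nat.cast_nonneg _)
  have h1 : 0 ≤ (∑ ω, g ω ^ q) / Fintype.card Ω :=
    div_nonneg (Finset.sum_nonneg fun ω _ => Real.rpow_nonneg (hg ω) q) (Nat.cast_nonneg _)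
  calc avgNorm p g ≤ (((∑ ω, g ω ^ q) / Fintype.card Ω) ^ (1 / (q / p))) ^ (1 / p) :=
        Real.rpow_le_rpow h0 h (by positivity)
    _ = avgNorm q g := by
        unfold avgNorm
        rw [← Real.rpow_mul h1]
        congr 1
        field_simp

/-- If the fourth moment is controlled by the second one, then the `L_2` norm is controlled by
the `L_p` norm for `p < 2`. -/
theorem avgNorm_two_le_of_fourth_moment [Nonempty Ω] {p K : ℝ} (hp : 0 < p) (hp2 : p < 2)
    (hK : 0 ≤ K) {g : Ω → ℝ} (hg : ∀ ω, 0 ≤ g ω)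
    (h4 : (∑ ω, g ω ^ 4) / Fintype.card Ω ≤ K * ((∑ ω, g ω ^ 2) / Fintype.card Ω) ^ 2) :
    avgNorm 2 g ≤ K ^ ((2 - p) / (2 * p)) * avgNorm p g := by
  have hc : (0 : ℝ) < Fintype.card Ω := Nat.cast_pos.2 Fintype.card_pos
  set M := avgNorm 2 g with hM
  set P := avgNorm p g with hP
  have hM0 : 0 ≤ M := avgNorm_nonneg hg
  have hP0 : 0 ≤ P := avgNorm_nonneg hg
  have hM2 : (∑ ω, g ω ^ 2) / Fintype.card Ω = M ^ 2 :=
    (avgNorm_natCast_pow (k := 2) two_ne_zero hg).symm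
  have hPp : (∑ ω, g ω ^ p) / Fintype.card Ω = P ^ p := (avgNorm_rpow hp hg).symm
  rcases hM0.eq_or_lt with h0 | hMpos
  · rw [← h0]; positivity
  have h4p : 0 < 4 - p := by linarith
  have h2p : 0 < 2 - p := by linarith
  -- Interpolation of `2` between `p` and `4`: `2 = p * a + 4 * b` with `a = 2 / (4 - p)`, `b = (2 -
  -- p) / (4 - p)` and `a + b = 1`.
  have hconj : ((4 - p) / 2).HolderConjugate ((4 - p) / (2 - p)) := by
    rw [Real.holderConjugate_iff]
    refine ⟨by rw [lt_div_iff₀ two_pos]; linarith, ?_⟩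
    field_simp; ring
  have hH := Real.inner_le_Lp_mul_Lq_of_nonneg Finset.univ hconj
    (f := fun ω => g ω ^ (p * (2 / (4 - p)))) (g := fun ω => g ω ^ (4 * ((2 - p) / (4 - p))))
    (fun ω _ => Real.rpow_nonneg (hg ω) _) (fun ω _ => Real.rpow_nonneg (hg ω) _)
  have e1 : ∀ ω, g ω ^ (p * (2 / (4 - p))) * g ω ^ (4 * ((2 - p) / (4 - p))) = g ω ^ 2 := by
    intro ω
    rw [← Real.rpow_add_of_nonneg (hg ω) (by positivity) (by positivity),
      ← Real.rpow_natCast]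
    congr 1
    field_simp
    push_cast; ring
  have e2 : ∀ ω, (g ω ^ (p * (2 / (4 - p)))) ^ ((4 - p) / 2) = g ω ^ p := by
    intro ω
    rw [← Real.rpow_mul (hg ω)]
    congr 1
    field_simp
  have e3 : ∀ ω, (g ω ^ (4 * ((2 - p) / (4 - p)))) ^ ((4 - p) / (2 - p)) = g ω ^ 4 := by
    intro ω
    rw [← Real.rpow_mul (hg ω), ← Real.rpow_natCast]
    congr 1
    field_simp
    norm_num
  simp_rw [e1, e2, e3, one_div_div] at hH
  have hS2 : ∑ ω, g ω ^ 2 = Fintype.card Ω * M ^ 2 := by rw [← hM2]; field_simp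
  have hSp : ∑ ω, g ω ^ p = Fintype.card Ω * P ^ p := by rw [← hPp]; field_simp
  have hS4 : ∑ ω, g ω ^ 4 ≤ Fintype.card Ω * (K * M ^ 4) := by
    rw [hM2, div_le_iff₀ hc] at h4
    linarith [h4]
  set c : ℝ := (Fintype.card Ω : ℝ)
  set a : ℝ := 2 / (4 - p) with ha
  set b : ℝ := (2 - p) / (4 - p) with hb
  have hb0 : 0 < b := by positivity
  have hab : a + b = 1 := by rw [ha, hb]; field_simp; ring
  have h5 : c * M ^ 2 ≤ c * ((P ^ p) ^ a * (K * M ^ 4) ^ b) := by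
    calc c * M ^ 2 ≤ (c * P ^ p) ^ a * (∑ ω, g ω ^ 4) ^ b := by rw [← hS2, ← hSp]; exact hH
      _ ≤ (c * P ^ p) ^ a * (c * (K * M ^ 4)) ^ b := by
          have : 0 ≤ ∑ ω, g ω ^ 4 := Finset.sum_nonneg fun ω _ => pow_nonneg (hg ω) 4
          gcongr
      _ = c ^ (a + b) * ((P ^ p) ^ a * (K * M ^ 4) ^ b) := by
          rw [Real.mul_rpow hc.le (by positivity), Real.mul_rpow hc.le (by positivity),
            Real.rpow_add hc]; ring
      _ = _ := by rw [hab, Real.rpow_one]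
  have h6 : M ^ 2 ≤ (P ^ p) ^ a * (K * M ^ 4) ^ b := le_of_mul_le_mul_left h5 hc
  have h7 : M ^ (2 - 4 * b) ≤ P ^ (p * a) * K ^ b := by
    rw [Real.rpow_sub hMpos, div_le_iff₀ (by positivity), Real.rpow_two]
    calc M ^ 2 ≤ (P ^ p) ^ a * (K * M ^ 4) ^ b := h6
      _ = _ := by
        rw [Real.mul_rpow hK (by positivity), ← Real.rpow_mul hP0, ← Real.rpow_natCast M 4,
          ← Real.rpow_mul hM0]
        push_cast; ring
  -- The exponent is the reciprocal of `2 - 4 * b = 2 * p / (4 - p)`, so `M` is left to the first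
  -- power.
  have h8 := Real.rpow_le_rpow (by positivity) h7 (z := (4 - p) / (2 * p)) (by positivity)
  rw [← Real.rpow_mul hM0, Real.mul_rpow (by positivity) (by positivity), ← Real.rpow_mul hP0,
    ← Real.rpow_mul hK] at h8
  have f1 : (2 - 4 * b) * ((4 - p) / (2 * p)) = 1 := by rw [hb]; field_simp; ring
  have f2 : p * a * ((4 - p) / (2 * p)) = 1 := by rw [ha]; field_simp
  have f3 : b * ((4 - p) / (2 * p)) = (2 - p) / (2 * p) := by rw [hb]; field_simp
  rw [f1, f2, f3, Real.rpow_one, Real.rpow_one] at h8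
  linarith

end AvgNorm

/-! ### Kahane–Khinchine inequalities -/

section Khinchine

variable {Y : Type*} [NormedAddCommGroup Y] [NormedSpace ℝ Y]

theorem moment_boolChaos_four_mul_le {m n : ℕ} (y : (Fin m → Fin n) → Y) (N : ℕ) :
    (∑ ω, ‖boolChaos y ω‖ ^ (4 * N)) / Fintype.card (Fin m → Fin n → Bool) ≤
      ((2 : ℝ) ^ m) ^ (4 * N) *
        ((∑ ω, ‖boolChaos y ω‖ ^ (2 * N)) / Fintype.card (Fin m → Fin n → Bool)) ^ 2 := by
  have h := sum_norm_boolChaos_pow_le y N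
  have hc : (0 : ℝ) < Fintype.card (Fin m → Fin n → Bool) := Nat.cast_pos.2 Fintype.card_pos
  set c : ℝ := (Fintype.card (Fin m → Fin n → Bool) : ℝ)
  rw [div_pow, mul_div_assoc', div_le_div_iff₀ hc (by positivity)]
  rw [one_div, inv_pow, inv_pow, inv_mul_le_iff₀ (by positivity)] at h
  calc (∑ ω, ‖boolChaos y ω‖ ^ (4 * N)) * c ^ 2
      = c * (∑ ω, ‖boolChaos y ω‖ ^ (4 * N)) * c := by ring
    _ ≤ _ := by gcongr

/-- The doubling step from `L_{2N}` to `L_{4N}` is iterated along `N = 2^k`; no constant depends on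
`n`. -/
theorem moment_boolChaos_two_pow_le (m k : ℕ) : ∃ C : ℝ, 0 < C ∧
    ∀ (n : ℕ) (y : (Fin m → Fin n) → Y),
      (∑ ω, ‖boolChaos y ω‖ ^ (2 ^ (k + 1))) / Fintype.card (Fin m → Fin n → Bool) ≤
        C * ((∑ ω, ‖boolChaos y ω‖ ^ 2) / Fintype.card (Fin m → Fin n → Bool)) ^ (2 ^ k) := by
  induction k with
  | zero => exact ⟨1, one_pos, fun n y => by simp⟩
  | succ k ih =>
    obtain ⟨C, hC, h⟩ := ih
    refine ⟨((2 : ℝ) ^ m) ^ (4 * 2 ^ k) * C ^ 2, by positivity, fun n y => ?_⟩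
    have h1 := moment_boolChaos_four_mul_le y (2 ^ k)
    have h2 := h n y
    rw [show 2 ^ (k + 1 + 1) = 4 * 2 ^ k by ring]
    refine h1.trans ?_
    rw [show 2 * 2 ^ k = 2 ^ (k + 1) by ring, mul_assoc]
    gcongr
    calc _ ≤ (C * ((∑ ω, ‖boolChaos y ω‖ ^ 2) /
          Fintype.card (Fin m → Fin n → Bool)) ^ (2 ^ k)) ^ 2 := by gcongr
      _ = _ := by rw [mul_pow, ← pow_mul, pow_succ 2 k]

variable (Y) in
/-- The `L_p` norm of a Rademacher chaos is at most a constant times its `L_2` norm. -/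
theorem exists_avgNorm_boolChaos_le_two (m : ℕ) {p : ℝ} (hp : 0 < p) : ∃ C : ℝ, 0 < C ∧
    ∀ (n : ℕ) (y : (Fin m → Fin n) → Y),
      avgNorm p (fun ω => ‖boolChaos y ω‖) ≤ C * avgNorm 2 (fun ω => ‖boolChaos y ω‖) := by
  obtain ⟨k, hk⟩ := pow_unbounded_of_one_lt p (one_lt_two : (1 : ℝ) < 2)
  obtain ⟨C, hC, h⟩ := moment_boolChaos_two_pow_le (Y := Y) m k
  refine ⟨C ^ ((1 : ℝ) / (2 ^ (k + 1) : ℕ)), by positivity, fun n y => ?_⟩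
  have hg : ∀ ω, 0 ≤ ‖boolChaos y ω‖ := fun ω => norm_nonneg _
  have hpk : p ≤ ((2 ^ (k + 1) : ℕ) : ℝ) := by
    push_cast
    exact hk.le.trans (pow_le_pow_right₀ one_le_two k.le_succ)
  refine (avgNorm_mono hp hpk hg).trans ?_
  have h1 := h n y
  have e2 := avgNorm_natCast_pow (k := 2) two_ne_zero hg
  rw [← avgNorm_natCast_pow (by positivity) hg, ← e2, ← pow_mul, ← pow_succ'] at h1
  refine le_of_pow_le_pow_left₀ (n := 2 ^ (k + 1)) (by positivity)
    (mul_nonneg (by positivity) (avgNorm_nonneg hg)) ?_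
  rw [mul_pow, ← Real.rpow_natCast (C ^ _), ← Real.rpow_mul hC.le, one_div_mul_cancel
    (by positivity), Real.rpow_one]
  exact_mod_cast h1

variable (Y) in
/-- The `L_2` norm of a Rademacher chaos is at most a constant times its `L_p` norm. -/
theorem exists_avgNorm_two_boolChaos_le (m : ℕ) {p : ℝ} (hp : 0 < p) : ∃ C : ℝ, 0 < C ∧
    ∀ (n : ℕ) (y : (Fin m → Fin n) → Y),
      avgNorm 2 (fun ω => ‖boolChaos y ω‖) ≤ C * avgNorm p (fun ω => ‖boolChaos y ω‖) := by
  rcases lt_or_ge p 2 with h2 | h2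
  · refine ⟨(((2 : ℝ) ^ m) ^ 4) ^ ((2 - p) / (2 * p)), by positivity, fun n y => ?_⟩
    exact avgNorm_two_le_of_fourth_moment hp h2 (by positivity) (fun ω => norm_nonneg _)
      (by simpa using moment_boolChaos_four_mul_le y 1)
  · exact ⟨1, one_pos, fun n y => by
      rw [one_mul]; exact avgNorm_mono two_pos h2 fun ω => norm_nonneg _⟩

end Khinchine

/-! ### Rademacher functions as independent binary digits -/

/-- The `k`-th binary digit of `t`, with `true` for the digit `0`. -/
noncomputable def dyadicBit (k : ℕ) (t : ℝ) : Bool := decide (Int.fract (2 ^ k * t) < 1 / 2)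

theorem dyadicBit_succ (k : ℕ) (t : ℝ) : dyadicBit (k + 1) t = dyadicBit k (2 * t) := by
  unfold dyadicBit
  rw [pow_succ, mul_assoc]

theorem dyadicBit_add_neg_one (k : ℕ) (t : ℝ) : dyadicBit k (t + -1) = dyadicBit k t := by
  unfold dyadicBit
  have : (2 : ℝ) ^ k * (t + -1) = 2 ^ k * t - ((2 ^ k : ℤ) : ℝ) := by push_cast; ring
  rw [this, Int.fract_sub_intCast]

theorem dyadicBit_zero {t : ℝ} (ht : t ∈ Set.Ico (0 : ℝ) 1) :
    dyadicBit 0 t = decide (t < 1 / 2) := by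
  unfold dyadicBit
  rw [pow_zero, one_mul, Int.fract_eq_self.2 ht]

theorem measurable_dyadicBit (k : ℕ) : Measurable (dyadicBit k) := by
  refine measurable_to_bool ?_
  have : dyadicBit k ⁻¹' {true} = {t : ℝ | Int.fract (2 ^ k * t) < 1 / 2} := by
    ext t; simp [dyadicBit]
  rw [this]
  exact measurableSet_lt (measurable_fract.comp (measurable_const_mul _)) measurable_const

/-- By periodicity only the fractional part of `2^k t` matters, and the sine is positive on its
first half. Zeros of the sine are excluded since `Real.sign` vanishes there. -/
theorem rademacher_succ_eq_boolSign {k : ℕ} {t : ℝ} (h : Real.sin (2 ^ (k + 1) * Real.pi * t) ≠ 0) :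
    rademacher (k + 1) t = boolSign (dyadicBit k t) := by
  unfold rademacher
  set u : ℝ := 2 ^ k * t with hu
  have e : Real.sin (2 ^ (k + 1) * Real.pi * t) = Real.sin (2 * Real.pi * Int.fract u) := by
    rw [← Real.sin_sub_int_mul_two_pi (2 ^ (k + 1) * Real.pi * t) ⌊u⌋, Int.fract, hu]
    congr 1; ring
  rw [e] at h ⊢
  have hf0 := Int.fract_nonneg u
  have hf1 := Int.fract_lt_one u
  have hpi := Real.pi_pos
  unfold dyadicBit
  rw [← hu]
  rcases lt_trichotomy (Int.fract u) (1 / 2) with h2 | h2 | h2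
  · have hpos : 0 < Int.fract u := by
      refine lt_of_le_of_ne hf0 fun h0 => h ?_
      rw [← h0]; simp
    rw [Real.sign_of_pos (Real.sin_pos_of_pos_of_lt_pi (by positivity) (by nlinarith))]
    rw [decide_eq_true h2, boolSign_true]
  · refine absurd ?_ h
    rw [h2, show 2 * Real.pi * (1 / 2) = Real.pi by ring, Real.sin_pi]
  · have : Real.sin (2 * Real.pi * Int.fract u) < 0 := by
      rw [← Real.sin_sub_two_pi]
      exact Real.sin_neg_of_neg_of_neg_pi_lt (by nlinarith) (by nlinarith)
    rw [Real.sign_of_neg this]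
    rw [decide_eq_false h2.not_gt, boolSign_false]

open MeasureTheory

theorem ae_rademacher_succ_eq_boolSign (k : ℕ) :
    ∀ᵐ t : ℝ, rademacher (k + 1) t = boolSign (dyadicBit k t) := by
  have hc : Set.Countable {t : ℝ | Real.sin (2 ^ (k + 1) * Real.pi * t) = 0} := by
    refine (Set.countable_range fun z : ℤ => (z : ℝ) / 2 ^ (k + 1)).mono fun t ht => ?_
    obtain ⟨z, hz⟩ := Real.sin_eq_zero_iff.1 ht
    refine ⟨z, ?_⟩
    have := Real.pi_ne_zero
    field_simp
    have h2 : (z : ℝ) * Real.pi = (2 ^ (k + 1) * t) * Real.pi := by rw [hz]; ring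
    have h3 := mul_right_cancel₀ this h2
    linarith
  filter_upwards [measure_eq_zero_iff_ae_notMem.1 (hc.measure_zero volume)] with t ht
  exact rademacher_succ_eq_boolSign ht

/-- The first `n` binary digits of a number. -/
noncomputable def dyadicBits (n : ℕ) (t : ℝ) (k : Fin n) : Bool := dyadicBit k t

theorem measurable_dyadicBits (n : ℕ) : Measurable (dyadicBits n) :=
  measurable_pi_iff.2 fun k => measurable_dyadicBit k

theorem dyadicBits_succ_eq_iff {n : ℕ} {t : ℝ} {ε : Fin (n + 1) → Bool} :
    dyadicBits (n + 1) t = ε ↔ dyadicBit 0 t = ε 0 ∧ dyadicBits n (2 * t) = Fin.tail ε := by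
  simp only [funext_iff, Fin.forall_fin_succ, dyadicBits, Fin.tail, Fin.val_succ, dyadicBit_succ,
    Fin.val_zero]

/-- The first digit selects a half of `[0, 1)`; doubling maps that half affinely onto `[0, 1)` and
shifts the remaining digits, so each digit costs a factor `1 / 2`. -/
theorem volume_dyadicBits_preimage (n : ℕ) (ε : Fin n → Bool) :
    volume (dyadicBits n ⁻¹' {ε} ∩ Set.Ico (0 : ℝ) 1) = 2⁻¹ ^ n := by
  induction n with
  | zero =>
    have : dyadicBits 0 ⁻¹' {ε} = Set.univ := Set.eq_univ_of_forall fun t => Subsingleton.elim _ _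
    simp [this]
  | succ n ih =>
    have h2 : ENNReal.ofReal |(2 : ℝ)⁻¹| = 2⁻¹ := by
      rw [abs_of_pos (by norm_num), ENNReal.ofReal_inv_of_pos two_pos, ENNReal.ofReal_ofNat]
    cases h : ε 0 with
    | true =>
      have : dyadicBits (n + 1) ⁻¹' {ε} ∩ Set.Ico (0 : ℝ) 1 =
          (fun t => 2 * t) ⁻¹' (dyadicBits n ⁻¹' {Fin.tail ε} ∩ Set.Ico (0 : ℝ) 1) := by
        ext t
        simp only [Set.mem_inter_iff, Set.mem_preimage, Set.mem_singleton_iff,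
          dyadicBits_succ_eq_iff, h]
        constructor
        · rintro ⟨⟨h0, h1⟩, ht⟩
          rw [dyadicBit_zero ht, decide_eq_true_eq] at h0
          exact ⟨h1, by linarith [ht.1], by linarith⟩
        · rintro ⟨h1, ha, hb⟩
          have ht : t ∈ Set.Ico (0 : ℝ) 1 := ⟨by linarith, by linarith⟩
          refine ⟨⟨?_, h1⟩, ht⟩
          rw [dyadicBit_zero ht, decide_eq_true_eq]
          linarith
      rw [this, Real.volume_preimage_mul_left two_ne_zero, ih, h2, pow_succ']
    | false =>
      have : dyadicBits (n + 1) ⁻¹' {ε} ∩ Set.Ico (0 : ℝ) 1 =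
          (fun t => 2 * t) ⁻¹' ((fun u => u + -1) ⁻¹'
            (dyadicBits n ⁻¹' {Fin.tail ε} ∩ Set.Ico (0 : ℝ) 1)) := by
        ext t
        have hper : dyadicBits n (2 * t + -1) = dyadicBits n (2 * t) :=
          funext fun k => dyadicBit_add_neg_one _ _
        simp only [Set.mem_inter_iff, Set.mem_preimage, Set.mem_singleton_iff,
          dyadicBits_succ_eq_iff, h, hper]
        constructor
        · rintro ⟨⟨h0, h1⟩, ht⟩
          rw [dyadicBit_zero ht, decide_eq_false_iff_not] at h0
          exact ⟨h1, by linarith, by linarith [ht.2]⟩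
        · rintro ⟨h1, ha, hb⟩
          have ht : t ∈ Set.Ico (0 : ℝ) 1 := ⟨by linarith, by linarith⟩
          refine ⟨⟨?_, h1⟩, ht⟩
          rw [dyadicBit_zero ht, decide_eq_false_iff_not]
          linarith
      rw [this, Real.volume_preimage_mul_left two_ne_zero, measure_preimage_add_right, ih, h2,
        pow_succ']

theorem map_dyadicBits_singleton (n : ℕ) (ε : Fin n → Bool) :
    (volume.restrict (Set.Icc (0 : ℝ) 1)).map (dyadicBits n) {ε} = 2⁻¹ ^ n := by
  rw [← Measure.restrict_congr_set Ico_ae_eq_Icc,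
    Measure.map_apply (measurable_dyadicBits n) (measurableSet_singleton _),
    Measure.restrict_apply (measurable_dyadicBits n (measurableSet_singleton _)),
    volume_dyadicBits_preimage]

theorem integral_comp_dyadicBits {n : ℕ} (F : (Fin n → Bool) → ℝ) :
    ∫ t in Set.Icc (0 : ℝ) 1, F (dyadicBits n t) =
      (∑ ω, F ω) / Fintype.card (Fin n → Bool) := by
  have hm := measurable_dyadicBits n
  rw [← integral_map (f := F) hm.aemeasurable (measurable_of_finite F).aestronglyMeasurable,
    integral_fintype .of_finite, Finset.sum_div]
  refine Finset.sum_congr rfl fun ω _ => ?_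
  rw [measureReal_def, map_dyadicBits_singleton]
  simp [div_eq_inv_mul]

theorem integral_comp_dyadicBits_pi {m n : ℕ} (F : (Fin m → Fin n → Bool) → ℝ) :
    ∫ t in Set.Icc (0 : Fin m → ℝ) 1, F (fun j => dyadicBits n (t j)) =
      (∑ ω, F ω) / Fintype.card (Fin m → Fin n → Bool) := by
  have hm := measurable_dyadicBits n
  have hr : (volume : Measure (Fin m → ℝ)).restrict (Set.Icc 0 1) =
      Measure.pi fun _ => volume.restrict (Set.Icc (0 : ℝ) 1) := by
    rw [← Measure.restrict_pi_pi, Set.pi_univ_Icc, volume_pi]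
    rfl
  have hmm : Measurable fun (t : Fin m → ℝ) j => dyadicBits n (t j) :=
    measurable_pi_iff.2 fun j => hm.comp (measurable_pi_apply j)
  rw [hr, ← integral_map (f := F) hmm.aemeasurable (measurable_of_finite F).aestronglyMeasurable,
    Measure.pi_map_pi fun _ => hm.aemeasurable,
    integral_fintype .of_finite, Finset.sum_div]
  refine Finset.sum_congr rfl fun ω _ => ?_
  rw [measureReal_def, Measure.pi_singleton]
  simp_rw [map_dyadicBits_singleton]
  simp [div_eq_inv_mul]

section

variable {Y : Type*} [NormedAddCommGroup Y] [NormedSpace ℝ Y]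

theorem integral_norm_sum_rademacher {n : ℕ} (s : ℝ) (y : Fin n → Y) :
    (∫ t in Set.Icc (0 : ℝ) 1, ‖∑ k : Fin n, rademacher ((k : ℕ) + 1) t • y k‖ ^ s) ^ (1 / s) =
      avgNorm s fun ω : Fin n → Bool => ‖∑ k, boolSign (ω k) • y k‖ := by
  unfold avgNorm
  rw [← integral_comp_dyadicBits fun ω : Fin n → Bool => ‖∑ k, boolSign (ω k) • y k‖ ^ s]
  congr 1
  refine integral_congr_ae (ae_restrict_of_ae ?_)
  filter_upwards [ae_all_iff.2 fun k : Fin n => ae_rademacher_succ_eq_boolSign k] with t ht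
  simp only [ht, dyadicBits]

theorem chaosNorm_eq_avgNorm {m n : ℕ} (p : ℝ) (y : (Fin m → Fin n) → Y) :
    chaosNorm p y = avgNorm p fun ω => ‖boolChaos y ω‖ := by
  unfold chaosNorm avgNorm
  rw [← integral_comp_dyadicBits_pi fun ω => ‖boolChaos y ω‖ ^ p]
  congr 1
  refine integral_congr_ae (ae_restrict_of_ae ?_)
  have h : ∀ᵐ t : Fin m → ℝ, ∀ (j : Fin m) (k : Fin n),
      rademacher ((k : ℕ) + 1) (t j) = boolSign (dyadicBit k (t j)) :=
    ae_all_iff.2 fun j => ae_all_iff.2 fun k =>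
      (Measure.quasiMeasurePreserving_eval (fun _ : Fin m => (volume : Measure ℝ)) j).ae
        (ae_rademacher_succ_eq_boolSign k)
  filter_upwards [h] with t ht
  simp only [ht, boolChaos, dyadicBits]

end

theorem avgNorm_comp_equiv {Ω Ω' : Type*} [Fintype Ω] [Fintype Ω'] (e : Ω ≃ Ω') (p : ℝ)
    (g : Ω' → ℝ) : avgNorm p (fun ω => g (e ω)) = avgNorm p g := by
  unfold avgNorm
  rw [Equiv.sum_comp e fun ω => g ω ^ p, Fintype.card_congr e]

/-! ### Cotype 2 for chaoses -/

section Cotype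

variable {Y : Type*} [NormedAddCommGroup Y] [NormedSpace ℝ Y]

theorem boolChaos_one {n : ℕ} (y : Fin n → Y) (ω : Fin 1 → Fin n → Bool) :
    boolChaos (fun i : Fin 1 → Fin n => y (i 0)) ω = ∑ k, boolSign (ω 0 k) • y k := by
  unfold boolChaos
  rw [← Equiv.sum_comp (Equiv.funUnique (Fin 1) (Fin n)).symm]
  simp

theorem boolChaos_cons {m n : ℕ} (y : (Fin (m + 1) → Fin n) → Y) (a : Fin n → Bool)
    (b : Fin m → Fin n → Bool) :
    boolChaos y (Fin.cons a b : Fin (m + 1) → Fin n → Bool) =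
      ∑ k, boolSign (a k) • boolChaos (fun i => y (Fin.cons k i)) b := by
  unfold boolChaos
  rw [← Equiv.sum_comp (Fin.consEquiv fun _ : Fin (m + 1) => Fin n), Fintype.sum_prod_type]
  refine Finset.sum_congr rfl fun k _ => ?_
  rw [Finset.smul_sum]
  refine Finset.sum_congr rfl fun i _ => ?_
  simp [Fin.consEquiv, Fin.prod_univ_succ, smul_smul]

/-- Cotype 2 with Rademacher averages in `L_s` implies cotype 2 with averages in `L_2`. -/
theorem HasCotype.exists_sum_norm_sq_le {s : ℝ} (hs : 0 < s) (hY : HasCotype Y 2 s) :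
    ∃ D : ℝ, 0 < D ∧ ∀ (n : ℕ) (y : Fin n → Y), ∑ k, ‖y k‖ ^ 2 ≤
      D * ((∑ ω : Fin n → Bool, ‖∑ k, boolSign (ω k) • y k‖ ^ 2) /
        Fintype.card (Fin n → Bool)) := by
  obtain ⟨C, hC, h⟩ := hY
  -- A Rademacher sum is a chaos of order `1`.
  obtain ⟨K, hK, hK'⟩ := exists_avgNorm_boolChaos_le_two Y 1 hs
  refine ⟨(C * K) ^ 2, by positivity, fun n y => ?_⟩
  have h1 := h n y
  have h2 := hK' n fun i => y (i 0)
  simp_rw [boolChaos_one] at h2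
  have e : ∀ q, avgNorm q (fun ω : Fin 1 → Fin n → Bool => ‖∑ k, boolSign (ω 0 k) • y k‖) =
      avgNorm q (fun ω : Fin n → Bool => ‖∑ k, boolSign (ω k) • y k‖) := fun q =>
    avgNorm_comp_equiv (Equiv.funUnique (Fin 1) (Fin n → Bool)) q
      fun ω : Fin n → Bool => ‖∑ k, boolSign (ω k) • y k‖
  rw [e, e] at h2
  rw [integral_norm_sum_rademacher] at h1
  have h0 : 0 ≤ ∑ k, ‖y k‖ ^ 2 := Finset.sum_nonneg fun _ _ => by positivity
  have h3 : √(∑ k, ‖y k‖ ^ 2) ≤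
      C * K * avgNorm 2 (fun ω : Fin n → Bool => ‖∑ k, boolSign (ω k) • y k‖) := by
    simp_rw [Real.rpow_two, ← Real.sqrt_eq_rpow] at h1
    rw [mul_assoc]
    exact h1.trans (by gcongr)
  have h4 := pow_le_pow_left₀ (Real.sqrt_nonneg _) h3 2
  rw [Real.sq_sqrt h0, mul_pow] at h4
  have e2 := avgNorm_natCast_pow (k := 2) two_ne_zero
    (g := fun ω : Fin n → Bool => ‖∑ k, boolSign (ω k) • y k‖) fun _ => norm_nonneg _
  rw [← e2]
  exact_mod_cast h4

/-- Iteration of the cotype 2 inequality over the variables of a chaos. -/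
theorem sum_norm_sq_le_boolChaos {D : ℝ} (hD : 0 < D)
    (h : ∀ (n : ℕ) (y : Fin n → Y), ∑ k, ‖y k‖ ^ 2 ≤
      D * ((∑ ω : Fin n → Bool, ‖∑ k, boolSign (ω k) • y k‖ ^ 2) / Fintype.card (Fin n → Bool)))
    (m n : ℕ) (y : (Fin m → Fin n) → Y) :
    ∑ i, ‖y i‖ ^ 2 ≤
      D ^ m * ((∑ ω, ‖boolChaos y ω‖ ^ 2) / Fintype.card (Fin m → Fin n → Bool)) := by
  induction m with
  | zero => simp [boolChaos]
  | succ m ih =>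
    calc ∑ i, ‖y i‖ ^ 2 = ∑ k, ∑ i : Fin m → Fin n, ‖y (Fin.cons k i)‖ ^ 2 := by
          rw [← Equiv.sum_comp (Fin.consEquiv fun _ : Fin (m + 1) => Fin n),
            Fintype.sum_prod_type]
          rfl
      _ ≤ ∑ k, D ^ m * ((∑ b, ‖boolChaos (fun i => y (Fin.cons k i)) b‖ ^ 2) /
            Fintype.card (Fin m → Fin n → Bool)) :=
          Finset.sum_le_sum fun k _ => ih fun i => y (Fin.cons k i)
      -- Because both sides carry squares, the sum over `k` passes inside the average over `b`;
      -- cotype is then applied in the first variable for each fixed `b`.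
      _ = D ^ m * ((∑ b, ∑ k, ‖boolChaos (fun i => y (Fin.cons k i)) b‖ ^ 2) /
            Fintype.card (Fin m → Fin n → Bool)) := by
          rw [Finset.sum_comm, ← Finset.mul_sum, Finset.sum_div]
      _ ≤ D ^ m * ((∑ b : Fin m → Fin n → Bool, D * ((∑ a : Fin n → Bool,
            ‖boolChaos y (Fin.cons a b : Fin (m + 1) → Fin n → Bool)‖ ^ 2) /
              Fintype.card (Fin n → Bool))) / Fintype.card (Fin m → Fin n → Bool)) := by
          gcongr with b
          simp_rw [boolChaos_cons]
          exact h n fun k => boolChaos (fun i => y (Fin.cons k i)) b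
      _ = D ^ (m + 1) * ((∑ ω, ‖boolChaos y ω‖ ^ 2) /
            Fintype.card (Fin (m + 1) → Fin n → Bool)) := by
          rw [← Equiv.sum_comp (Fin.consEquiv fun _ : Fin (m + 1) => Fin n → Bool),
            Fintype.sum_prod_type_right,
            ← Fintype.card_congr (Fin.consEquiv fun _ : Fin (m + 1) => Fin n → Bool),
            Fintype.card_prod, ← Finset.mul_sum, ← Finset.sum_div]
          push_cast
          simp only [Fin.consEquiv, Equiv.coe_fn_mk]
          field_simp
          ring

end Cotype

/-- Hölder's inequality comparing `ℓ_r` and `ℓ_2` norms on a finite set. -/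
theorem sum_rpow_rpow_inv_le_card_mul_sqrt {ι : Type*} [Fintype ι] [Nonempty ι] {r : ℝ}
    (hr : 0 < r) (hr2 : r ≤ 2) {a : ι → ℝ} (ha : ∀ i, 0 ≤ a i) :
    (∑ i, a i ^ r) ^ (1 / r) ≤ (Fintype.card ι : ℝ) ^ (1 / r - 1 / 2) * √(∑ i, a i ^ 2) := by
  have hc : (0 : ℝ) < Fintype.card ι := Nat.cast_pos.2 Fintype.card_pos
  have h := avgNorm_mono hr hr2 ha
  have h0 : 0 ≤ ∑ i, a i ^ r := Finset.sum_nonneg fun i _ => Real.rpow_nonneg (ha i) r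
  have h2 : 0 ≤ ∑ i, a i ^ 2 := Finset.sum_nonneg fun i _ => by positivity
  unfold avgNorm at h
  simp_rw [Real.rpow_two] at h
  rw [Real.div_rpow h0 hc.le, Real.div_rpow h2 hc.le, ← Real.sqrt_eq_rpow,
    div_le_iff₀ (by positivity)] at h
  refine h.trans_eq ?_
  rw [Real.rpow_sub hc, ← Real.sqrt_eq_rpow]
  ring

/-! ### Constant arrays and optimality -/

section Sharpness

theorem sum_sq_sum_boolSign (n : ℕ) :
    ∑ ω : Fin n → Bool, (∑ k, boolSign (ω k)) ^ 2 = n * Fintype.card (Fin n → Bool) := by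
  induction n with
  | zero => simp
  | succ n ih =>
    have hz : ∀ x : ℝ, (1 + x) ^ 2 + (-1 + x) ^ 2 = 2 + 2 * x ^ 2 := fun x => by ring
    rw [← Equiv.sum_comp (Fin.consEquiv fun _ : Fin (n + 1) => Bool), Fintype.sum_prod_type,
      Fintype.sum_bool, ← Finset.sum_add_distrib]
    simp only [Fin.consEquiv, Equiv.coe_fn_mk, Fin.sum_univ_succ, Fin.cons_zero, Fin.cons_succ,
      boolSign_true, boolSign_false, hz]
    rw [Finset.sum_add_distrib, ← Finset.mul_sum, ih]
    simp
    ring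

variable {Y : Type*} [NormedAddCommGroup Y] [NormedSpace ℝ Y]

theorem boolChaos_const {m n : ℕ} (v : Y) (ω : Fin m → Fin n → Bool) :
    boolChaos (fun _ => v) ω = (∏ j, ∑ k, boolSign (ω j k)) • v := by
  unfold boolChaos
  rw [← Finset.sum_smul, sum_pi_prod fun j k => boolSign (ω j k)]

/-- A constant array makes the chaos a product of `m` independent sign sums, each with second moment
`n`. -/
theorem avgNorm_two_boolChaos_const (m n : ℕ) (v : Y) :
    avgNorm 2 (fun ω : Fin m → Fin n → Bool => ‖boolChaos (fun _ => v) ω‖) =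
      (n : ℝ) ^ ((m : ℝ) / 2) * ‖v‖ := by
  have h : ∀ ω : Fin m → Fin n → Bool, ‖boolChaos (fun _ => v) ω‖ ^ 2 =
      (∏ j, (∑ k, boolSign (ω j k)) ^ 2) * ‖v‖ ^ 2 := by
    intro ω
    rw [boolChaos_const, norm_smul, mul_pow, Real.norm_eq_abs, sq_abs, Finset.prod_pow]
  unfold avgNorm
  simp_rw [Real.rpow_two, h]
  rw [← Finset.sum_mul, sum_pi_prod fun (_ : Fin m) (x : Fin n → Bool) => (∑ k, boolSign (x k)) ^ 2]
  simp_rw [sum_sq_sum_boolSign]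
  rw [← Real.sqrt_eq_rpow, Finset.prod_const, Fintype.card_fun (α := Fin m), mul_pow]
  have e : (n : ℝ) ^ ((m : ℝ) / 2) = √((n : ℝ) ^ m) := by
    rw [Real.sqrt_eq_rpow, ← Real.rpow_natCast, ← Real.rpow_mul (Nat.cast_nonneg _)]
    congr 1; ring
  rw [e, ← Real.sqrt_sq (norm_nonneg v), ← Real.sqrt_mul (by positivity),
    Real.sqrt_sq (norm_nonneg v)]
  congr 1
  have hB : (Fintype.card (Fin n → Bool) : ℝ) ≠ 0 := Nat.cast_ne_zero.2 Fintype.card_ne_zero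
  rw [Finset.card_univ]
  push_cast [Fintype.card_fin] at hB ⊢
  field_simp

end Sharpness

theorem le_of_forall_natCast_rpow_le {a b C : ℝ}
    (h : ∀ n : ℕ, 1 ≤ n → (n : ℝ) ^ a ≤ C * (n : ℝ) ^ b) : a ≤ b := by
  by_contra! hab
  have ht := (tendsto_rpow_atTop (sub_pos.2 hab)).comp tendsto_natCast_atTop_atTop
  obtain ⟨n, hn, hn1⟩ := ((ht.eventually_gt_atTop C).and (Filter.eventually_ge_atTop 1)).exists
  have hpos : (0 : ℝ) < n := by exact_mod_cast hn1
  simp only [Function.comp_apply, Real.rpow_sub hpos] at hn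
  rw [lt_div_iff₀ (by positivity)] at hn
  exact (h n hn1).not_gt hn

theorem mainTheorem3 (Y : Type*) [NormedAddCommGroup Y] [NormedSpace ℝ Y] [CompleteSpace Y]
    [Nontrivial Y] (s : ℝ) (hs : 0 < s) (hY : HasCotype Y 2 s)
    (m : ℕ) (hm : 1 ≤ m) (p : ℝ) (hp : 0 < p) :
    (∃ c : ℝ, 0 < c ∧ ∀ r : ℝ, 0 < r → r ≤ 2 →
      ∀ n : ℕ, 1 ≤ n → ∀ y : (Fin m → Fin n) → Y,
        (∑ i, ‖y i‖ ^ r) ^ (1 / r) ≤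
          c * (n : ℝ) ^ ((m : ℝ) * (1 / r - 1 / 2)) * chaosNorm p y) ∧
    (∀ r : ℝ, 0 < r → r ≤ 2 → ∀ t : ℝ,
      (∃ c : ℝ, 0 < c ∧ ∀ n : ℕ, 1 ≤ n → ∀ y : (Fin m → Fin n) → Y,
        (∑ i, ‖y i‖ ^ r) ^ (1 / r) ≤ c * (n : ℝ) ^ t * chaosNorm p y) →
      (m : ℝ) * (1 / r - 1 / 2) ≤ t) := by
  constructor
  · obtain ⟨D, hD, hcot⟩ := hY.exists_sum_norm_sq_le hs
    obtain ⟨K, hK, hK'⟩ := exists_avgNorm_two_boolChaos_le Y m hp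
    -- The constant is free of `r`, which enters only through Hölder.
    refine ⟨√(D ^ m) * K, by positivity, fun r hr hr2 n hn y => ?_⟩
    have : NeZero n := ⟨by omega⟩
    have h1 := sum_rpow_rpow_inv_le_card_mul_sqrt hr hr2 fun i => norm_nonneg (y i)
    have h2 := Real.sqrt_le_sqrt (sum_norm_sq_le_boolChaos hD hcot m n y)
    have e2 := avgNorm_natCast_pow (k := 2) two_ne_zero
      (g := fun ω => ‖boolChaos y ω‖) fun _ => norm_nonneg _
    rw [← e2, Real.sqrt_mul (by positivity), Real.sqrt_sq (avgNorm_nonneg fun _ => norm_nonneg _),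
      Nat.cast_ofNat] at h2
    have e3 : (Fintype.card (Fin m → Fin n) : ℝ) ^ (1 / r - 1 / 2) =
        (n : ℝ) ^ ((m : ℝ) * (1 / r - 1 / 2)) := by
      rw [Fintype.card_fun, Fintype.card_fin, Fintype.card_fin, Nat.cast_pow, ← Real.rpow_natCast,
        ← Real.rpow_mul (Nat.cast_nonneg _)]
    rw [e3] at h1
    rw [chaosNorm_eq_avgNorm]
    calc (∑ i, ‖y i‖ ^ r) ^ (1 / r)
        ≤ (n : ℝ) ^ ((m : ℝ) * (1 / r - 1 / 2)) * √(∑ i, ‖y i‖ ^ 2) := h1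
      _ ≤ (n : ℝ) ^ ((m : ℝ) * (1 / r - 1 / 2)) *
          (√(D ^ m) * (K * avgNorm p fun ω => ‖boolChaos y ω‖)) := by
          gcongr
          exact h2.trans (mul_le_mul_of_nonneg_left (hK' n y) (Real.sqrt_nonneg _))
      _ = _ := by ring
  · rintro r hr - t ⟨c, hc, h⟩
    obtain ⟨K, hK, hK'⟩ := exists_avgNorm_boolChaos_le_two Y m hp
    obtain ⟨v, hv⟩ := exists_ne (0 : Y)
    have hv0 : 0 < ‖v‖ := norm_pos_iff.2 hv
    suffices hsuff : (m : ℝ) / r ≤ t + m / 2 by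
      have : (m : ℝ) * (1 / r - 1 / 2) = m / r - m / 2 := by ring
      linarith
    refine le_of_forall_natCast_rpow_le (C := c * K) fun n hn => ?_
    have hn0 : (0 : ℝ) < n := by exact_mod_cast hn
    have h1 := h n hn fun _ => v
    have h2 := hK' n fun _ => v
    rw [avgNorm_two_boolChaos_const] at h2
    rw [chaosNorm_eq_avgNorm] at h1
    have e : (∑ _i : Fin m → Fin n, ‖v‖ ^ r) ^ (1 / r) = (n : ℝ) ^ ((m : ℝ) / r) * ‖v‖ := by
      rw [Finset.sum_const, Finset.card_univ, Fintype.card_fun, Fintype.card_fin,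
        Fintype.card_fin, nsmul_eq_mul, Real.mul_rpow (by positivity) (by positivity),
        ← Real.rpow_mul hv0.le, mul_one_div_cancel hr.ne', Real.rpow_one, Nat.cast_pow,
        ← Real.rpow_natCast, ← Real.rpow_mul hn0.le, mul_one_div]
    rw [e] at h1
    refine le_of_mul_le_mul_right ?_ hv0
    calc (n : ℝ) ^ ((m : ℝ) / r) * ‖v‖
        ≤ c * (n : ℝ) ^ t * (K * ((n : ℝ) ^ ((m : ℝ) / 2) * ‖v‖)) :=
          h1.trans (mul_le_mul_of_nonneg_left h2 (by positivity))
      _ = c * K * (n : ℝ) ^ (t + m / 2) * ‖v‖ := by rw [Real.rpow_add hn0]; ring
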